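/- All rings are commutative with identity, not necessarily Noetherian. A ring $S$ is *coherent* if every finitely generated ideal of $S$ is finitely presented, and *regular* if every finitely generated ideal of $S$ has finite projective dimension. For a ring homomorphism $f : R \to S$, $R$ is a *module retract* of $S$ if there is an $R$-linear map $\rho : S \to R$ with $\rho(f(r)) = r$ for all $r \in R$. Let $\mathbf{x} = x_1, \dots, x_\ell$ be a finite sequence in $R$. Let $C(x)$ be the cochain complex $0 \to R \to R_x \to 0$ in degrees $0, 1$ (the localization map), let $C(\mathbf{x}) = C(x_1) \otimes_R \cdots \otimes_R C(x_\ell)$ be the Čech complex, and let $H^i_{\mathbf{x}}(R)$ be its $i$-th cohomology. Let $K(x)$ be the chain complex $0 \to R \xrightarrow{x} R \to 0$ in degrees $1, 0$, let $K(\mathbf{x}) = K(x_1) \otimes_R \cdots \otimes_R K(x_\ell)$ be the Koszul complex, and let $H_i(\mathbf{x})$ be its $i$-th homology. For $m \ge n$ let $\phi^m_n(\mathbf{x}) = \phi^m_n(x_1) \otimes \cdots \otimes \phi^m_n(x_\ell) : K(\mathbf{x}^m) \to K(\mathbf{x}^n)$, where $\mathbf{x}^m = x_1^m, \dots, x_\ell^m$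 and $\phi^m_n(x) : K(x^m) \to K(x^n)$ is the identity in degree $0$ and multiplication by $x^{m-n}$ in degree $1$. The sequence $\mathbf{x}$ is *weakly proregular* if for each $n$ there is $m \ge n$ such that the maps $H_i(\mathbf{x}^m) \to H_i(\mathbf{x}^n)$ induced by $\phi^m_n(\mathbf{x})$ are zero for all $i \ge 1$. The sequence $\mathbf{x}$ is a *parameter sequence* on $R$ if it is weakly proregular, $(\mathbf{x})R \ne R$, and $H^\ell_{\mathbf{x}}(R)_p \ne 0$ for every prime ideal $p$ of $R$ containing $(\mathbf{x})R$. It is a *strong parameter sequence* on $R$ if $x_1, \dots, x_i$ is a parameter sequence on $R$ for $i = 1, \dots, \ell$. It is a *regular sequence* on $R$ if $x_i$ is a non-zero-divisor on $R/(x_1, \dots, x_{i-1})R$ for $i = 1, \dots, \ell$ and $(\mathbf{x})R \ne R$; by convention the empty sequence is regular on every ring. **Theorem.** Let $R \subseteq S$ be commutative rings such that $R$ is a module retract of $S$, $S$ is finitely generated as an $R$-module, and $S$ is a coherent regular ring. Then every strong parameter sequence $\mathbf{x}$ on $R$ of length $\ell \le 2$ is a regular sequence on $R$. -/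

import Mathlib

open CategoryTheory

universe u v

noncomputable section

namespace NonNoetherian

variable {R : Type u} [CommRing R]

/-! ### Čech cohomology -/

/-- The cochain complex with `R` in degree `0` and zero in every other degree: the Čech complex
of the empty sequence. -/
def cechNil (R : Type u) [CommRing R] : CochainComplex (ModuleCat.{u} R) ℕ :=
  (CochainComplex.single₀ (ModuleCat.{u} R)).obj (ModuleCat.of R R)

/-- Localization of an `R`-linear map at the powers of `x`, as an `R`-linear map. -/
def awayMap (x : R) {M N : Type u} [AddCommGroup M] [Module R M] [AddCommGroup N] [Module R N]
    (f : M →ₗ[R] N) :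
    LocalizedModule (Submonoid.powers x) M →ₗ[R] LocalizedModule (Submonoid.powers x) N :=
  IsLocalizedModule.map (Submonoid.powers x)
    (LocalizedModule.mkLinearMap (Submonoid.powers x) M)
    (LocalizedModule.mkLinearMap (Submonoid.powers x) N) f

/-- The terms of `K ⊗ C(x)`, where `C(x)` is the complex `0 → R → Rₓ → 0`:
`(K ⊗ C(x))⁰ = K⁰` and `(K ⊗ C(x))ⁿ⁺¹ = Kⁿ⁺¹ ⊕ (Kⁿ)ₓ`. -/
def cechStepX (K : CochainComplex (ModuleCat.{u} R) ℕ) (x : R) : ℕ → ModuleCat.{u} R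
  | 0 => K.X 0
  | n + 1 => ModuleCat.of R (K.X (n + 1) × LocalizedModule (Submonoid.powers x) (K.X n))

/-- The differential of `K ⊗ C(x)`: `a ↦ (da, a/1)` in degree `0`, and
`(a, b) ↦ (da, db + (-1)ⁿ⁺¹ a/1)` in degree `n + 1`. -/
def cechStepD (K : CochainComplex (ModuleCat.{u} R) ℕ) (x : R) :
    ∀ n : ℕ, cechStepX K x n ⟶ cechStepX K x (n + 1)
  | 0 => ModuleCat.ofHom (LinearMap.prod (K.d 0 1).hom
      (LocalizedModule.mkLinearMap (Submonoid.powers x) (K.X 0)))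
  | n + 1 => ModuleCat.ofHom (LinearMap.prod
      ((K.d (n + 1) (n + 2)).hom ∘ₗ LinearMap.fst R _ _)
      (awayMap x (K.d n (n + 1)).hom ∘ₗ LinearMap.snd R _ _ +
        (-1 : R) ^ (n + 1) •
          (LocalizedModule.mkLinearMap (Submonoid.powers x) (K.X (n + 1)) ∘ₗ
            LinearMap.fst R _ _)))

theorem awayMap_mk (x : R) {M N : Type u} [AddCommGroup M] [Module R M] [AddCommGroup N]
    [Module R N] (f : M →ₗ[R] N) (m : M) (s : Submonoid.powers x) :
    awayMap x f (LocalizedModule.mk m s) = LocalizedModule.mk (f m) s :=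
  IsLocalizedModule.map_LocalizedModules _ _ _ _

theorem d_d_apply {ι : Type} {c : ComplexShape ι}
    (K : HomologicalComplex (ModuleCat.{u} R) c) (i j k : ι) (a : K.X i) :
    (K.d j k).hom ((K.d i j).hom a) = 0 := by
  rw [← LinearMap.comp_apply, ← ModuleCat.hom_comp, K.d_comp_d]; rfl

theorem cechStepD_comp (K : CochainComplex (ModuleCat.{u} R) ℕ) (x : R) (n : ℕ) :
    cechStepD K x n ≫ cechStepD K x (n + 1) = 0 := by
  have key : ∀ (m : ℕ) (b : LocalizedModule (Submonoid.powers x) (K.X m)),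
      awayMap x (K.d (m + 1) (m + 2)).hom (awayMap x (K.d m (m + 1)).hom b) = 0 := by
    intro m b
    induction b using LocalizedModule.induction_on with
    | _ b s => rw [awayMap_mk, awayMap_mk, d_d_apply, LocalizedModule.zero_mk]
  have key2 : ∀ (m : ℕ) (a : K.X m),
      awayMap x (K.d m (m + 1)).hom (LocalizedModule.mkLinearMap (Submonoid.powers x) (K.X m) a) =
        LocalizedModule.mkLinearMap (Submonoid.powers x) (K.X (m + 1)) ((K.d m (m + 1)).hom a) :=
    fun m a => awayMap_mk x _ a 1
  cases n with
  | zero =>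
    refine ModuleCat.hom_ext (LinearMap.ext fun (a : K.X 0) => Prod.ext (d_d_apply K 0 1 2 a) ?_)
    change awayMap x (K.d 0 1).hom (LocalizedModule.mkLinearMap (Submonoid.powers x) (K.X 0) a) +
      (-1 : R) ^ (0 + 1) • LocalizedModule.mkLinearMap (Submonoid.powers x) (K.X 1)
        ((K.d 0 1).hom a) = 0
    rw [key2]
    simp
  | succ n =>
    refine ModuleCat.hom_ext (LinearMap.ext fun a =>
      Prod.ext (d_d_apply K (n + 1) (n + 2) (n + 3) a.1) ?_)
    change awayMap x (K.d (n + 1) (n + 2)).hom (awayMap x (K.d n (n + 1)).hom a.2 +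
        (-1 : R) ^ (n + 1) • LocalizedModule.mkLinearMap (Submonoid.powers x) (K.X (n + 1)) a.1) +
      (-1 : R) ^ (n + 1 + 1) • LocalizedModule.mkLinearMap (Submonoid.powers x) (K.X (n + 2))
        ((K.d (n + 1) (n + 2)).hom a.1) = 0
    rw [map_add, map_smul, key, key2, pow_succ (-1 : R) (n + 1)]
    simp

/-- The tensor product `K ⊗ C(x)`. -/
def cechStep (K : CochainComplex (ModuleCat.{u} R) ℕ) (x : R) :
    CochainComplex (ModuleCat.{u} R) ℕ :=
  CochainComplex.of (cechStepX K x) (cechStepD K x) (cechStepD_comp K x)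

/-- The Čech complex `C(x₁, …, xₗ) = C(x₁, …, xₗ₋₁) ⊗ C(xₗ)` of a finite sequence. -/
def cechComplex (xs : List R) : CochainComplex (ModuleCat.{u} R) ℕ :=
  xs.foldl cechStep (cechNil R)

/-- The Čech cohomology module `Hⁱ_x(R)`. -/
def cechCohomology (xs : List R) (i : ℕ) : ModuleCat.{u} R :=
  (cechComplex xs).homology i

/-! ### Koszul homology and weakly proregular sequences -/

/-- The chain complex with `R` in degree `0` and zero in every other degree: the Koszul complex
of the empty sequence. -/
def koszulNil (R : Type u) [CommRing R] : ChainComplex (ModuleCat.{u} R) ℕ :=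
  (ChainComplex.single₀ (ModuleCat.{u} R)).obj (ModuleCat.of R R)

/-- The terms of `K ⊗ K(x)`, where `K(x)` is the complex `0 → R → R → 0` given by multiplication
by `x`: `(K ⊗ K(x))₀ = K₀` and `(K ⊗ K(x))ₙ₊₁ = Kₙ₊₁ ⊕ Kₙ`. -/
def koszulStepX (K : ChainComplex (ModuleCat.{u} R) ℕ) : ℕ → ModuleCat.{u} R
  | 0 => K.X 0
  | n + 1 => ModuleCat.of R (K.X (n + 1) × K.X n)

/-- The differential of `K ⊗ K(x)`: `(a, b) ↦ da + xb` in degree `1`, and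
`(a, b) ↦ (da + (-1)ⁿ⁺¹ xb, db)` in degree `n + 2`. -/
def koszulStepD (K : ChainComplex (ModuleCat.{u} R) ℕ) (x : R) :
    ∀ n : ℕ, koszulStepX K (n + 1) ⟶ koszulStepX K n
  | 0 => ModuleCat.ofHom (LinearMap.coprod (K.d 1 0).hom (x • LinearMap.id))
  | n + 1 => ModuleCat.ofHom (LinearMap.prod
      (LinearMap.coprod (K.d (n + 2) (n + 1)).hom (((-1 : R) ^ (n + 1) * x) • LinearMap.id))
      ((K.d (n + 1) n).hom ∘ₗ LinearMap.snd R _ _))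

theorem koszulStepD_comp (K : ChainComplex (ModuleCat.{u} R) ℕ) (x : R) (n : ℕ) :
    koszulStepD K x (n + 1) ≫ koszulStepD K x n = 0 := by
  cases n with
  | zero =>
    refine ModuleCat.hom_ext (LinearMap.ext fun a => ?_)
    change (K.d 1 0).hom ((K.d 2 1).hom a.1 + ((-1 : R) ^ (0 + 1) * x) • a.2) +
      x • (K.d 1 0).hom a.2 = 0
    rw [map_add, map_smul, d_d_apply]
    simp
  | succ n =>
    refine ModuleCat.hom_ext (LinearMap.ext fun a => Prod.ext ?_ (d_d_apply K _ _ _ a.2))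
    change (K.d (n + 2) (n + 1)).hom ((K.d (n + 3) (n + 2)).hom a.1 +
        ((-1 : R) ^ (n + 1 + 1) * x) • a.2) +
      ((-1 : R) ^ (n + 1) * x) • (K.d (n + 2) (n + 1)).hom a.2 = 0
    rw [map_add, map_smul, d_d_apply, pow_succ (-1 : R) (n + 1)]
    simp

/-- The tensor product `K ⊗ K(x)`. -/
def koszulStep (K : ChainComplex (ModuleCat.{u} R) ℕ) (x : R) :
    ChainComplex (ModuleCat.{u} R) ℕ :=
  ChainComplex.of (koszulStepX K) (koszulStepD K x) (koszulStepD_comp K x)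

/-- The Koszul complex `K(x₁, …, xₗ) = K(x₁) ⊗ ⋯ ⊗ K(xₗ)` of a finite sequence. -/
def koszulComplex (xs : List R) : ChainComplex (ModuleCat.{u} R) ℕ :=
  xs.foldl koszulStep (koszulNil R)

/-- The components of `f ⊗ φ : K ⊗ K(xᵐ) ⟶ L ⊗ K(xⁿ)`, where `φ : K(xᵐ) ⟶ K(xⁿ)` is
the identity in degree `0` and multiplication by `xᵐ⁻ⁿ` in degree `1`. -/
def koszulStepMapF {K L : ChainComplex (ModuleCat.{u} R) ℕ} (f : K ⟶ L) (x : R) (m n : ℕ) :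
    ∀ i : ℕ, koszulStepX K i ⟶ koszulStepX L i
  | 0 => f.f 0
  | i + 1 => ModuleCat.ofHom
      (LinearMap.prodMap (f.f (i + 1)).hom (x ^ (m - n) • (f.f i).hom))

theorem koszulStepMapF_comm {K L : ChainComplex (ModuleCat.{u} R) ℕ} (f : K ⟶ L) (x : R)
    {m n : ℕ} (h : n ≤ m) (i : ℕ) :
    koszulStepMapF f x m n (i + 1) ≫ koszulStepD L (x ^ n) i =
      koszulStepD K (x ^ m) i ≫ koszulStepMapF f x m n i := by
  have hf : ∀ (j k : ℕ) (a : K.X j), (L.d j k).hom ((f.f j).hom a) = (f.f k).hom ((K.d j k).hom a) :=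
    fun j k a => by
      rw [← LinearMap.comp_apply, ← LinearMap.comp_apply, ← ModuleCat.hom_comp,
        ← ModuleCat.hom_comp, f.comm]
  have hx : x ^ n * x ^ (m - n) = x ^ m := by rw [← pow_add, Nat.add_sub_cancel' h]
  cases i with
  | zero =>
    refine ModuleCat.hom_ext (LinearMap.ext fun a => ?_)
    change (L.d 1 0).hom ((f.f 1).hom a.1) + x ^ n • x ^ (m - n) • (f.f 0).hom a.2 =
      (f.f 0).hom ((K.d 1 0).hom a.1 + x ^ m • a.2)
    rw [map_add, map_smul, hf, smul_smul, hx]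
  | succ i =>
    refine ModuleCat.hom_ext (LinearMap.ext fun a => Prod.ext ?_ ?_)
    · change (L.d (i + 2) (i + 1)).hom ((f.f (i + 2)).hom a.1) +
          ((-1 : R) ^ (i + 1) * x ^ n) • x ^ (m - n) • (f.f (i + 1)).hom a.2 =
        (f.f (i + 1)).hom ((K.d (i + 2) (i + 1)).hom a.1 + ((-1 : R) ^ (i + 1) * x ^ m) • a.2)
      rw [map_add, map_smul, hf, smul_smul, mul_assoc, hx]
    · change (L.d (i + 1) i).hom (x ^ (m - n) • (f.f (i + 1)).hom a.2) =
        x ^ (m - n) • (f.f i).hom ((K.d (i + 1) i).hom a.2)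
      rw [map_smul, hf]

/-- The chain map `f ⊗ φ : K ⊗ K(xᵐ) ⟶ L ⊗ K(xⁿ)`. -/
def koszulStepMap {K L : ChainComplex (ModuleCat.{u} R) ℕ} (f : K ⟶ L) (x : R)
    {m n : ℕ} (h : n ≤ m) : koszulStep K (x ^ m) ⟶ koszulStep L (x ^ n) :=
  ChainComplex.ofHom (koszulStepMapF f x m n) (fun i => by
    simpa [koszulStep] using koszulStepMapF_comm f x h i)

/-- The map `f ⊗ φ(x₁) ⊗ ⋯ ⊗ φ(xₗ)`, for a chain map `f : K ⟶ L`. -/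
def koszulPowMapAux {m n : ℕ} (h : n ≤ m) :
    ∀ (xs : List R) {K L : ChainComplex (ModuleCat.{u} R) ℕ} (_ : K ⟶ L),
      (xs.map (· ^ m)).foldl koszulStep K ⟶ (xs.map (· ^ n)).foldl koszulStep L
  | [], _, _, f => f
  | x :: xs, _, _, f => koszulPowMapAux h xs (koszulStepMap f x h)

/-- The chain map `K(x₁ᵐ, …, xₗᵐ) ⟶ K(x₁ⁿ, …, xₗⁿ)`, for `m ≥ n`, given by
`φ(x₁) ⊗ ⋯ ⊗ φ(xₗ)`. -/
def koszulPowMap (xs : List R) {m n : ℕ} (h : n ≤ m) :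
    koszulComplex (xs.map (· ^ m)) ⟶ koszulComplex (xs.map (· ^ n)) :=
  koszulPowMapAux h xs (𝟙 (koszulNil R))

/-- A finite sequence is weakly proregular if for each `n` there is `m ≥ n` such that the maps
`Hᵢ(xᵐ) → Hᵢ(xⁿ)` on Koszul homology are zero for all `i ≥ 1`. -/
def IsWeaklyProregular (xs : List R) : Prop :=
  ∀ n : ℕ, ∃ (m : ℕ) (h : n ≤ m), ∀ i : ℕ, 1 ≤ i →
    HomologicalComplex.homologyMap (koszulPowMap xs h) i = 0

/-! ### Parameter sequences and regular sequences -/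

/-- A parameter sequence on `R`: weakly proregular, generating a proper ideal, and with
`H^ℓ_x(R)_p ≠ 0` for every prime `p` containing the sequence, where `ℓ` is its length. -/
structure IsParameterSequence (xs : List R) : Prop where
  weaklyProregular : IsWeaklyProregular xs
  ne_top : Ideal.ofList xs ≠ ⊤
  nontrivial_localized : ∀ (p : Ideal R) [p.IsPrime], Ideal.ofList xs ≤ p →
    Nontrivial (LocalizedModule p.primeCompl (cechCohomology xs xs.length))

/-- A strong parameter sequence: `x₁, …, xᵢ` is a parameter sequence for `i = 1, …, ℓ`. -/
def IsStrongParameterSequence (xs : List R) : Prop :=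
  ∀ i : ℕ, 1 ≤ i → i ≤ xs.length → IsParameterSequence (xs.take i)

/-- A regular sequence on the ring `R`. By convention the empty sequence is regular on every ring
(Mathlib's `RingTheory.Sequence.IsRegular` agrees, except over the zero ring). -/
def IsRegularSequence (xs : List R) : Prop :=
  xs = [] ∨ RingTheory.Sequence.IsRegular R xs

/-! ### Coherent regular rings and module retracts -/

/-- Every finitely generated ideal is finitely presented. -/
def IsCoherentRing (S : Type u) [CommRing S] : Prop :=
  ∀ I : Ideal S, I.FG → Module.FinitePresentation S I

/-- Every finitely generated ideal has finite projective dimension. No Noetherian hypothesis. -/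
def IsRegularRing (S : Type u) [CommRing S] : Prop :=
  ∀ I : Ideal S, I.FG → ∃ n : ℕ, HasProjectiveDimensionLE (ModuleCat.of S I) n

/-- `R` is a module retract of the `R`-algebra `S`. In particular `R → S` is then injective. -/
def IsModuleRetract (R : Type u) (S : Type v) [CommRing R] [CommRing S] [Algebra R S] : Prop :=
  ∃ ρ : S →ₗ[R] R, ∀ r : R, ρ (algebraMap R S r) = r

end NonNoetherian

end

namespace NonNoetherian

open TensorProduct

/-! Coherence and regularity give every finitely generated ideal of `S` a finite resolution by
finite projectives, a property inherited by localizations. It has two consequences, both through an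
Auslander–Buchsbaum argument without Noetherian hypotheses (`HasFiniteResolution.free_of_depth`). A
local ring `A` with the property is a domain, by comparing ranks at the generic points. If `A` is a
domain, `x ≠ 0` and `P` is minimal over an ideal `(x : r)`, then `A_P` has depth one, so its
finitely generated ideals are free, hence principal, and `A_P` is a valuation ring. Consequently `A`
is integrally closed.

The retraction `ρ` provides, over each prime `p` of `R`, a prime `Q` of `S` such that divisibility
in `S_Q` between elements of `R_p` descends to `R_p`. Thus `R_p` is a domain and is integrally
closed.

A parameter `x` is a nonzerodivisor: otherwise, at a suitable prime, `x` vanishes in a domain `R_p`,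
which kills the localized top Čech cohomology. Now suppose that `y` is a zero divisor modulo `x`,
say `x ∣ r * y` but `¬ x ∣ r`. Choose `Q` over a maximal ideal containing `(x : r)`, and `P` minimal
over `(x : r)` in `S_Q`. The localization at `P` is a valuation ring, so one of `x`, `y` divides the
other there. Minimal polynomials over the integrally closed ring `R_p` convert this into `x ∣ d * y
^ i` or `y ∣ d * x ^ i`, with `d` outside the contraction of `P` to `R`
(`exists_prime_dvd_mul_pow`). At that prime `(x, y)` is a principal ideal up to radical, so `H²`
vanishes there, against the parameter condition. -/

/-! ### Finite free resolutions -/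

/-- `M` has a resolution of length `n` by finite projective modules, all of which except possibly
the last are free. -/
def HasFiniteResolution (A : Type v) [CommRing A] :
    ℕ → ∀ (M : Type v) [AddCommGroup M] [Module A M], Prop
  | 0, M, _, _ => Module.Finite A M ∧ Module.Projective A M
  | n + 1, M, _, _ => ∃ (F : Type v) (_ : AddCommGroup F) (_ : Module A F) (f : F →ₗ[A] M),
      Module.Finite A F ∧ Module.Free A F ∧ Function.Surjective f ∧
        HasFiniteResolution A n (LinearMap.ker f)

/-- Every finitely generated ideal has a finite resolution by finite projective modules. -/
def HasFiniteResolutions (A : Type v) [CommRing A] : Prop :=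
  ∀ I : Ideal A, I.FG → ∃ n, HasFiniteResolution A n I

section

variable {A : Type v} [CommRing A]

theorem HasFiniteResolution.of_equiv {n : ℕ} {M N : Type v} [AddCommGroup M] [Module A M]
    [AddCommGroup N] [Module A N] (e : M ≃ₗ[A] N) (h : HasFiniteResolution A n M) :
    HasFiniteResolution A n N := by
  cases n with
  | zero =>
    have := h.1
    have := h.2
    exact ⟨Module.Finite.equiv e, Module.Projective.of_equiv e⟩
  | succ n =>
    obtain ⟨F, _, _, f, h1, h2, h3, h4⟩ := h
    refine ⟨F, _, _, e.toLinearMap ∘ₗ f, h1, h2, e.surjective.comp h3, ?_⟩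
    rwa [LinearEquiv.ker_comp]

theorem HasFiniteResolution.baseChange (B : Type v) [CommRing B] [Algebra A B] [Module.Flat A B]
    {n : ℕ} {M : Type v} [AddCommGroup M] [Module A M] (h : HasFiniteResolution A n M) :
    HasFiniteResolution B n (B ⊗[A] M) := by
  induction n generalizing M with
  | zero =>
    have := h.1
    have := h.2
    exact ⟨inferInstance, inferInstance⟩
  | succ n ih =>
    obtain ⟨F, _, _, f, h1, h2, h3, h4⟩ := h
    exact ⟨B ⊗[A] F, _, _, AlgebraTensorModule.lTensor B B f, inferInstance, inferInstance,
      LinearMap.lTensor_surjective B h3, (ih h4).of_equiv (LinearMap.tensorKerEquiv B B f)⟩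

/-- Extension of an ideal along a flat ring homomorphism, as a base change. -/
noncomputable def tensorIdealEquiv (B : Type v) [CommRing B] [Algebra A B] [Module.Flat A B]
    (J : Ideal A) : B ⊗[A] J ≃ₗ[B] J.map (algebraMap A B) :=
  let g : B ⊗[A] J →ₗ[B] B := (AlgebraTensorModule.rid A B B).toLinearMap ∘ₗ
    AlgebraTensorModule.lTensor B B J.subtype
  have hg : Function.Injective g := (AlgebraTensorModule.rid A B B).injective.comp
    (Module.Flat.lTensor_preserves_injective_linearMap J.subtype J.injective_subtype)
  have hr : LinearMap.range g = J.map (algebraMap A B) := by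
    apply le_antisymm
    · rintro _ ⟨z, rfl⟩
      induction z with
      | zero => simp
      | add a b ha hb => rw [map_add]; exact add_mem ha hb
      | tmul b j =>
        have : g (b ⊗ₜ j) = b * algebraMap A B j := by simp [g, Algebra.smul_def, mul_comm]
        rw [this]
        exact Ideal.mul_mem_left _ _ (Ideal.mem_map_of_mem _ j.2)
    · refine Ideal.map_le_iff_le_comap.2 fun j hj => ⟨1 ⊗ₜ ⟨j, hj⟩, ?_⟩
      simp [g, Algebra.smul_def]
  (LinearEquiv.ofInjective g hg).trans (LinearEquiv.ofEq _ _ hr)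

/-- Clearing denominators of generators shows that a finitely generated ideal of `B` is extended
from one of `A`; flat base change then carries its resolution over. -/
theorem HasFiniteResolutions.of_isLocalization (W : Submonoid A) (B : Type v) [CommRing B]
    [Algebra A B] [IsLocalization W B] (h : HasFiniteResolutions A) : HasFiniteResolutions B := by
  intro I hI
  have := IsLocalization.flat B W
  obtain ⟨J, hJ, rfl⟩ : ∃ J : Ideal A, J.FG ∧ J.map (algebraMap A B) = I := by
    classical
    obtain ⟨s, rfl⟩ := hI
    refine ⟨Ideal.span (s.image fun b => (IsLocalization.sec W b).1), ⟨_, rfl⟩, ?_⟩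
    have hsec : ∀ b : B, algebraMap A B (IsLocalization.sec W b).1 =
        algebraMap A B (IsLocalization.sec W b).2 * b := fun b =>
      (IsLocalization.sec_spec' W b)
    rw [Ideal.map_span]
    apply le_antisymm <;> refine Ideal.span_le.2 ?_
    · rintro _ ⟨_, ha, rfl⟩
      obtain ⟨b, hb, rfl⟩ := Finset.mem_image.1 (Finset.mem_coe.1 ha)
      rw [hsec]
      exact Ideal.mul_mem_left _ _ (Ideal.subset_span hb)
    · intro b hb
      refine (Ideal.unit_mul_mem_iff_mem _
        (IsLocalization.map_units B (IsLocalization.sec W b).2)).1 ?_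
      rw [← hsec]
      exact Ideal.subset_span ⟨_, Finset.mem_coe.2 (Finset.mem_image_of_mem _ hb), rfl⟩
  obtain ⟨n, hn⟩ := h J hJ
  exact ⟨n, (hn.baseChange B).of_equiv (tensorIdealEquiv B J)⟩

/-- Projection to the first coordinate has a finitely generated ideal as image, finitely presented
by coherence. The kernel is therefore finitely generated and embeds in the remaining `k`
coordinates, where induction applies. -/
theorem IsCoherentRing.finitePresentation_submodule (hA : IsCoherentRing A) {k : ℕ}
    (N : Submodule A (Fin k → A)) (hN : N.FG) : Module.FinitePresentation A N := by
  induction k with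
  | zero =>
    have : Module.Finite A N := Module.Finite.iff_fg.2 hN
    have : Module.Projective A N := inferInstance
    exact Module.finitePresentation_of_projective A N
  | succ k ih =>
    have : Module.Finite A N := Module.Finite.iff_fg.2 hN
    let p : (Fin (k + 1) → A) →ₗ[A] A := LinearMap.proj 0
    let l : N →ₗ[A] N.map p := p.submoduleMap N
    have hl : Function.Surjective l := p.submoduleMap_surjective N
    have hfp : Module.FinitePresentation A (N.map p) := hA _ (hN.map p)
    have hk : (LinearMap.ker l).FG := Module.FinitePresentation.fg_ker l hl
    let t : LinearMap.ker l →ₗ[A] (Fin k → A) :=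
      LinearMap.funLeft A A Fin.succ ∘ₗ N.subtype ∘ₗ (LinearMap.ker l).subtype
    have ht : Function.Injective t := by
      intro z z' hz
      have h0 : ∀ z : LinearMap.ker l, (z : N).1 0 = 0 := fun z =>
        congrArg Subtype.val (show l z = 0 from z.2)
      refine Subtype.ext (Subtype.ext (funext fun i => ?_))
      refine Fin.cases ?_ (fun i => ?_) i
      · exact (h0 z).trans (h0 z').symm
      · exact congrFun hz i
    have : Module.Finite A (LinearMap.ker l) := Module.Finite.iff_fg.2 hk
    have hr : Module.FinitePresentation A (LinearMap.range t) :=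
      ih _ (by rw [LinearMap.range_eq_map]; exact (Module.Finite.fg_top).map t)
    have : Module.FinitePresentation A (LinearMap.ker l) :=
      Module.FinitePresentation.of_equiv (R := A) (M := LinearMap.range t) (N := LinearMap.ker l)
        (LinearEquiv.ofInjective t ht).symm
    exact Module.finitePresentation_of_ker l hl

/-- Coherence keeps each syzygy finitely presented, and passing to a syzygy lowers the bound on the
projective dimension by one. -/
theorem IsCoherentRing.hasFiniteResolution (hA : IsCoherentRing A) (n : ℕ) (M : Type v)
    [AddCommGroup M] [Module A M] (hM : Module.FinitePresentation A M)
    (hn : HasProjectiveDimensionLE (ModuleCat.of A M) n) : HasFiniteResolution A n M := by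
  induction n generalizing M with
  | zero =>
    refine ⟨inferInstance, ?_⟩
    rw [← projective_iff_hasProjectiveDimensionLE_zero, ← IsProjective.iff_projective] at hn
    exact hn
  | succ n ih =>
    obtain ⟨k, f, hf⟩ := Module.Finite.exists_fin' A M
    let T := ModuleCat.shortComplexOfCompEqZero (LinearMap.ker f).subtype f
      (LinearMap.exact_subtype_ker_map f).linearMap_comp_eq_zero
    have hT : T.ShortExact :=
      { exact := (ShortComplex.ShortExact.moduleCat_exact_iff_function_exact T).2
          (LinearMap.exact_subtype_ker_map f)
        mono_f := (ModuleCat.mono_iff_injective _).2 (LinearMap.ker f).injective_subtype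
        epi_g := (ModuleCat.epi_iff_surjective _).2 hf }
    have hP : Projective T.X₂ :=
      (IsProjective.iff_projective (Fin k → A)).1 inferInstance
    exact ⟨Fin k → A, _, _, f, inferInstance, inferInstance, hf,
      ih _ (hA.finitePresentation_submodule _ (Module.FinitePresentation.fg_ker f hf))
        ((hT.hasProjectiveDimensionLT_X₃_iff n hP).1 hn)⟩

theorem IsCoherentRing.hasFiniteResolutions (hA : IsCoherentRing A) (hR : IsRegularRing A) :
    HasFiniteResolutions A := fun I hI =>
  let ⟨n, hn⟩ := hR I hI
  ⟨n, hA.hasFiniteResolution n I (hA I hI) hn⟩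

/-! ### Rings of small depth -/

/-- Over a local ring, if every finitely generated proper ideal consists of zero divisors modulo
`x`, then `M` is free if it has a finite resolution and `x` is `M`-regular (or zero). -/
theorem HasFiniteResolution.free_of_depth [IsLocalRing A] (x : A)
    (hJ : ∀ J : Ideal A, J.FG → J ≤ IsLocalRing.maximalIdeal A →
      ∃ c, ¬ x ∣ c ∧ ∀ j ∈ J, x ∣ c * j)
    (hA : x = 0 ∨ ∀ a : A, x * a = 0 → a = 0) {n : ℕ} {M : Type v} [AddCommGroup M] [Module A M]
    (h : HasFiniteResolution A n M) (hM : x = 0 ∨ ∀ a : M, x • a = 0 → a = 0) :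
    Module.Finite A M ∧ Module.Free A M := by
  induction n generalizing M with
  | zero =>
    have := h.1
    have := h.2
    exact ⟨inferInstance, Module.free_of_flat_of_isLocalRing⟩
  | succ n ih =>
    obtain ⟨F, _, _, f, h1, h2, h3, h4⟩ := h
    have hF : x = 0 ∨ ∀ a : F, x • a = 0 → a = 0 := by
      refine hA.imp_right fun hx a ha => ?_
      let b := Module.Free.chooseBasis A F
      refine b.repr.map_eq_zero_iff.1 (Finsupp.ext fun i => hx _ ?_)
      simpa using DFunLike.congr_fun (congrArg b.repr ha) i
    obtain ⟨hKf, hK⟩ := ih h4 (hF.imp_right fun hx a ha => Subtype.ext (hx _ (by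
      simpa using congrArg Subtype.val ha)))
    refine ⟨Module.Finite.of_surjective f h3, ?_⟩
    -- The kernel is free by induction, so `M` is free once the kernel stays injective in `F` modulo
    -- the maximal ideal.
    refine Module.free_of_lTensor_residueField_injective (LinearMap.ker f).subtype f h3
      (LinearMap.exact_subtype_ker_map f) ?_
    refine (injective_iff_map_eq_zero _).2 fun z hz => ?_
    obtain ⟨e, rfl⟩ : ∃ e : LinearMap.ker f, (1 : IsLocalRing.ResidueField A) ⊗ₜ[A] e = z :=
      TensorProduct.mk_surjective A _ _ IsLocalRing.residue_surjective z
    have hz' : (1 : IsLocalRing.ResidueField A) ⊗ₜ[A] (e : F) = 0 := hz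
    have hm : ∀ φ : F →ₗ[A] A, φ e ∈ IsLocalRing.maximalIdeal A := fun φ => by
      have := congrArg (TensorProduct.rid A _) (congrArg (φ.lTensor _) hz')
      simpa [Algebra.smul_def] using this
    let b := Module.Free.chooseBasis A F
    let b' := Module.Free.chooseBasis A (LinearMap.ker f)
    -- The coordinates of `e` in `F` generate a finitely generated proper ideal, so some `c` outside
    -- `(x)` multiplies `e` into `x F`.
    obtain ⟨c, hc, hcJ⟩ := hJ (Ideal.span (Set.range fun i => b.coord i e))
      (Submodule.fg_span (Set.finite_range _))
      (Ideal.span_le.2 (by rintro _ ⟨i, rfl⟩; exact hm _))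
    choose g hg using fun i => hcJ (b.coord i e) (Ideal.subset_span ⟨i, rfl⟩)
    obtain ⟨w, hw⟩ : ∃ w : F, c • (e : F) = x • w := by
      refine ⟨∑ i, g i • b i, b.repr.injective (Finsupp.ext fun i => ?_)⟩
      simpa [b.repr_sum_self, Finsupp.single_apply] using hg i
    -- The quotient `w` already lies in the kernel, because `x • f w = c • f e = 0` and `x` is
    -- regular on `M`.
    obtain ⟨w', hw'⟩ : ∃ w' : LinearMap.ker f, c • e = x • w' := by
      rcases hM with rfl | hM
      · exact ⟨0, Subtype.ext (by simpa using hw)⟩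
      · refine ⟨⟨w, hM _ ?_⟩, Subtype.ext hw⟩
        rw [← map_smul, ← hw, map_smul, e.2, smul_zero]
    have hu : ∀ i, b'.coord i e ∈ IsLocalRing.maximalIdeal A := fun i => by
      by_contra hi
      have hi : IsUnit (b'.coord i e) := by simpa using hi
      -- A unit coordinate of `e` in the kernel would make `x` divide `c`.
      refine hc ((hi.dvd_mul_right).1 ⟨b'.coord i w', ?_⟩)
      simpa using congrArg (b'.coord i) hw'
    rw [← b'.sum_repr e, TensorProduct.tmul_sum]
    refine Finset.sum_eq_zero fun i _ => ?_
    rw [← TensorProduct.smul_tmul, Algebra.smul_def, IsLocalRing.ResidueField.algebraMap_eq,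
      (IsLocalRing.residue_eq_zero_iff _).2 (by simpa using hu i), zero_mul, TensorProduct.zero_tmul]

end

open TensorProduct

section

variable {A : Type v} [CommRing A]

/-- The fibre ranks of a module with a finite resolution over a local ring are constant on
flat residue fields. -/
theorem HasFiniteResolution.exists_finrank_eq [IsLocalRing A] {n : ℕ} {M : Type v}
    [AddCommGroup M] [Module A M] (h : HasFiniteResolution A n M) :
    ∃ r : ℤ, ∀ (L : Type v) [Field L] [Algebra A L] [Module.Flat A L],
      (Module.finrank L (L ⊗[A] M) : ℤ) = r := by
  induction n generalizing M with
  | zero =>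
    have := h.1
    have := h.2
    have : Module.Free A M := Module.free_of_flat_of_isLocalRing
    exact ⟨Module.finrank A M, fun L _ _ _ => by rw [Module.finrank_baseChange]⟩
  | succ n ih =>
    obtain ⟨F, _, _, f, h1, h2, h3, h4⟩ := h
    obtain ⟨r, hr⟩ := ih h4
    refine ⟨Module.finrank A F - r, fun L _ _ _ => ?_⟩
    -- Flatness of `L` identifies the kernel after base change with the base change of the kernel,
    -- so rank-nullity makes `r` an alternating sum of ranks independent of `L`.
    have e := LinearMap.finrank_range_add_finrank_ker (AlgebraTensorModule.lTensor L L f)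
    have hs : Function.Surjective (AlgebraTensorModule.lTensor L L f) :=
      LinearMap.lTensor_surjective L h3
    rw [LinearMap.range_eq_top.2 hs, finrank_top,
      Module.finrank_baseChange (M' := F), ← (LinearMap.tensorKerEquiv L L f).finrank_eq] at e
    rw [← hr L, ← e]
    push_cast
    ring

/-- The ideal of all `a` such that `r * a` is divisible by `x`. -/
def divisorIdeal (x r : A) : Ideal A :=
  Submodule.comap (LinearMap.mulLeft A r) (Ideal.span {x})

theorem mem_divisorIdeal {x r a : A} : a ∈ divisorIdeal x r ↔ x ∣ r * a :=
  Ideal.mem_span_singleton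

/-- Finite generation puts some power of `J` inside `(x : r)`. If `k + 1` is the least such
exponent, `r` times an element of `J ^ k` outside `(x : r)` is a witness. -/
theorem exists_not_dvd_of_pow_dvd {x r : A} (hr : ¬ x ∣ r) {J : Ideal A} (hJ : J.FG)
    (h : ∀ a ∈ J, ∃ k : ℕ, x ∣ r * a ^ k) : ∃ c, ¬ x ∣ c ∧ ∀ j ∈ J, x ∣ c * j := by
  let N : Ideal A := divisorIdeal x r
  have hN : ∀ a, a ∈ N ↔ x ∣ r * a := fun a => mem_divisorIdeal
  have hex : ∃ k, J ^ k ≤ N := Ideal.exists_pow_le_of_le_radical_of_fg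
    (fun a ha => (h a ha).imp fun k hk => (hN _).2 hk) hJ
  classical
  have hmin := Nat.find_spec hex
  obtain ⟨k, hk⟩ : ∃ k, Nat.find hex = k + 1 := by
    refine Nat.exists_eq_succ_of_ne_zero fun h0 => hr ?_
    rw [h0, pow_zero, Ideal.one_eq_top] at hmin
    simpa using (hN 1).1 (hmin trivial)
  have hk' : ¬ J ^ k ≤ N := Nat.find_min hex (by omega)
  obtain ⟨c, hc, hcN⟩ := SetLike.not_le_iff_exists.1 hk'
  refine ⟨r * c, fun hd => hcN ((hN c).2 hd), fun j hj => ?_⟩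
  rw [mul_assoc]
  refine (hN _).1 (hmin ?_)
  rw [hk, pow_succ]
  exact Ideal.mul_mem_mul hc hj

theorem divisorIdeal_ne_top {x r : A} (h : ¬ x ∣ r) : divisorIdeal x r ≠ ⊤ := fun h' => h (by
  simpa using mem_divisorIdeal.1 (h' ▸ Submodule.mem_top : (1 : A) ∈ divisorIdeal x r))

theorem not_dvd_localization {x r : A} {Q : Ideal A} [Q.IsPrime] (h : divisorIdeal x r ≤ Q)
    (B : Type v) [CommRing B] [Algebra A B] [IsLocalization.AtPrime B Q] :
    ¬ algebraMap A B x ∣ algebraMap A B r := by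
  rintro ⟨b, hb⟩
  obtain ⟨⟨a, s⟩, hs⟩ := IsLocalization.surj Q.primeCompl b
  have : algebraMap A B (r * s) = algebraMap A B (x * a) := by
    rw [map_mul, hb, mul_assoc, hs, map_mul]
  obtain ⟨t, ht⟩ := (IsLocalization.eq_iff_exists Q.primeCompl B).1 this
  exact (s * t : Q.primeCompl).2 (h (mem_divisorIdeal.2 ⟨t * a, by
    push_cast
    linear_combination ht⟩))

/-- By minimality of `Q`, the maximal ideal of `B` is the radical of the extension of `(x : r)`.
This supplies the depth hypothesis of `HasFiniteResolution.free_of_depth`. -/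
theorem depth_localization {x r : A} {Q : Ideal A} [Q.IsPrime]
    (h : Q ∈ (divisorIdeal x r).minimalPrimes)
    (B : Type v) [CommRing B] [Algebra A B] [IsLocalization.AtPrime B Q] [IsLocalRing B]
    (J : Ideal B) (hJ : J.FG) (hJm : J ≤ IsLocalRing.maximalIdeal B) :
    ∃ c, ¬ algebraMap A B x ∣ c ∧ ∀ j ∈ J, algebraMap A B x ∣ c * j := by
  refine exists_not_dvd_of_pow_dvd (not_dvd_localization h.1.2 B) hJ fun a ha => ?_
  have ha := hJm ha
  rw [← IsLocalization.AtPrime.map_eq_maximalIdeal Q B,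
    ← IsLocalization.AtPrime.radical_map_of_mem_minimalPrimes B Q _ h] at ha
  obtain ⟨k, hk⟩ := ha
  refine ⟨k, ?_⟩
  have : (divisorIdeal x r).map (algebraMap A B) ≤
      divisorIdeal (algebraMap A B x) (algebraMap A B r) :=
    Ideal.map_le_iff_le_comap.2 fun a ha => mem_divisorIdeal.2 (by
      rw [← map_mul]; exact map_dvd _ (mem_divisorIdeal.1 ha))
  exact mem_divisorIdeal.1 (this hk)

/-- With `x = 0`, a principal ideal inside the maximal ideal is free yet killed by some `c ≠ 0`; its
basis must be empty, so the maximal ideal is zero. -/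
theorem HasFiniteResolutions.isField_of_depth_zero [IsLocalRing A] (h : HasFiniteResolutions A)
    (hJ : ∀ J : Ideal A, J.FG → J ≤ IsLocalRing.maximalIdeal A →
      ∃ c, ¬ (0 : A) ∣ c ∧ ∀ j ∈ J, 0 ∣ c * j) : IsField A := by
  rw [IsLocalRing.isField_iff_maximalIdeal_eq, eq_bot_iff]
  intro a ha
  have hfg : (Ideal.span {a}).FG := Submodule.fg_span_singleton a
  obtain ⟨n, hn⟩ := h _ hfg
  obtain ⟨-, hfree⟩ := hn.free_of_depth 0 hJ (.inl rfl) (.inl rfl)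
  obtain ⟨c, hc, hca⟩ := hJ _ hfg ((Ideal.span_singleton_le_iff_mem _).2 ha)
  rw [zero_dvd_iff] at hc
  let b := Module.Free.chooseBasis A (Ideal.span {a})
  have hz : (⟨a, Ideal.mem_span_singleton_self a⟩ : Ideal.span {a}) = 0 := by
    refine b.repr.map_eq_zero_iff.1 (Finsupp.ext fun i => ?_)
    have h1 : c • b i = 0 := Subtype.ext (by simpa using hca _ (b i).2)
    refine absurd ?_ hc
    simpa using DFunLike.congr_fun (congrArg b.repr h1) i
  exact congrArg Subtype.val hz

/-- The prime is one minimal over the annihilator of `a`, where the depth is zero. -/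
theorem exists_isField_localization (h : HasFiniteResolutions A) {a : A} (ha : a ≠ 0) :
    ∃ (Q : Ideal A) (_ : Q.IsPrime), (∀ b, b * a = 0 → b ∈ Q) ∧
      IsField (Localization.AtPrime Q) ∧ algebraMap A (Localization.AtPrime Q) a ≠ 0 := by
  have ha' : ¬ (0 : A) ∣ a := by rwa [zero_dvd_iff]
  obtain ⟨⟨Q, hQ⟩⟩ := Ideal.nonempty_minimalPrimes (divisorIdeal_ne_top ha')
  have := hQ.1.1
  refine ⟨Q, this, fun b hb => hQ.1.2 (mem_divisorIdeal.2 (by rw [mul_comm, hb])), ?_, ?_⟩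
  · refine (h.of_isLocalization Q.primeCompl _).isField_of_depth_zero ?_
    simpa using depth_localization hQ (Localization.AtPrime Q)
  · have := not_dvd_localization hQ.1.2 (Localization.AtPrime Q)
    rwa [map_zero, zero_dvd_iff] at this

/-- A local ring all of whose finitely generated ideals have finite resolutions is a domain. -/
theorem HasFiniteResolutions.isDomain [IsLocalRing A] (h : HasFiniteResolutions A) :
    IsDomain A := by
  have : NoZeroDivisors A := ⟨fun {a b} hab => by
    by_contra! hne
    obtain ⟨ha, hb⟩ := hne
    obtain ⟨n, hn⟩ := h (Ideal.span {a}) (Submodule.fg_span_singleton a)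
    obtain ⟨r, hr⟩ := hn.exists_finrank_eq
    -- The ideal `(a)` has rank one at `Q₁`, where `a` is a unit, and rank zero at `Q₂`, which
    -- contains `a` because `a * b = 0`. Constancy of the rank is contradicted.
    obtain ⟨Q₁, _, -, hF₁, ha₁⟩ := exists_isField_localization h ha
    obtain ⟨Q₂, _, hQ₂, hF₂, -⟩ := exists_isField_localization h hb
    have h₁ : r = 1 := by
      let := hF₁.toField
      have : Module.Flat A (Localization.AtPrime Q₁) := IsLocalization.flat _ Q₁.primeCompl
      rw [← hr (Localization.AtPrime Q₁), (tensorIdealEquiv _ _).finrank_eq, Ideal.map_span,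
        Set.image_singleton, Ideal.span_singleton_eq_top.2 (isUnit_iff_ne_zero.2 ha₁), finrank_top,
        Module.finrank_self, Nat.cast_one]
    have h₂ : r = 0 := by
      have ha₂ : algebraMap A (Localization.AtPrime Q₂) a = 0 := by
        by_contra ha₂
        obtain ⟨c, hc⟩ := hF₂.mul_inv_cancel ha₂
        exact (IsLocalization.AtPrime.isUnit_to_map_iff _ Q₂ a).1
          (IsUnit.of_mul_eq_one c hc) (hQ₂ a hab)
      let := hF₂.toField
      have : Module.Flat A (Localization.AtPrime Q₂) := IsLocalization.flat _ Q₂.primeCompl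
      rw [← hr (Localization.AtPrime Q₂), (tensorIdealEquiv _ _).finrank_eq, Ideal.map_span,
        Set.image_singleton, ha₂, Ideal.span_singleton_eq_bot.2 rfl, finrank_bot, Nat.cast_zero]
    omega⟩
  exact NoZeroDivisors.to_isDomain A

/-- Two distinct basis elements `u`, `v` would satisfy the nontrivial relation `v • u = u • v`. -/
theorem isPrincipal_of_free [IsDomain A] (I : Ideal A) [Module.Free A I] :
    Submodule.IsPrincipal I := by
  let b := Module.Free.chooseBasis A I
  have hs : Subsingleton (Module.Free.ChooseBasisIndex A I) := ⟨fun i j => by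
    by_contra hij
    have h : (b j : A) • b i = (b i : A) • b j := Subtype.ext (mul_comm _ _)
    have h' := DFunLike.congr_fun (congrArg b.repr h) i
    simp only [map_smul, b.repr_self, Finsupp.smul_apply, Finsupp.single_eq_same,
      Finsupp.single_eq_of_ne hij, smul_eq_mul, mul_one, mul_zero] at h'
    exact b.ne_zero j (Subtype.ext h')⟩
  have hsp := congrArg (Submodule.map I.subtype) b.span_eq
  rw [Submodule.map_span, Submodule.map_top, Submodule.range_subtype] at hsp
  rcases isEmpty_or_nonempty (Module.Free.ChooseBasisIndex A I) with _ | ⟨⟨i⟩⟩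
  · rw [Set.range_eq_empty, Set.image_empty, Submodule.span_empty] at hsp
    rw [← hsp]
    infer_instance
  · have := uniqueOfSubsingleton i
    rw [Set.range_unique, Set.image_singleton] at hsp
    exact ⟨_, hsp.symm⟩

/-- Two-generated ideals of the localization are torsion-free with finite resolutions, hence free by
the depth condition modulo `x`, hence principal; a local Bézout domain is a valuation ring. -/
theorem HasFiniteResolutions.valuationRing_localization [IsDomain A] (h : HasFiniteResolutions A)
    {x r : A} (hx : x ≠ 0) {Q : Ideal A} [Q.IsPrime] (hQ : Q ∈ (divisorIdeal x r).minimalPrimes) :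
    ValuationRing (Localization.AtPrime Q) := by
  have : IsDomain (Localization.AtPrime Q) :=
    IsLocalization.isDomain_localization Q.primeCompl_le_nonZeroDivisors
  have hx' : algebraMap A (Localization.AtPrime Q) x ≠ 0 := by
    rwa [Ne, FaithfulSMul.algebraMap_eq_zero_iff]
  refine ValuationRing.iff_local_bezout_domain.2 ⟨inferInstance,
    IsBezout.iff_span_pair_isPrincipal.2 fun a b => ?_⟩
  obtain ⟨n, hn⟩ := h.of_isLocalization Q.primeCompl (Localization.AtPrime Q) (Ideal.span {a, b})
    (Submodule.fg_span (by simp))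
  have hreg : ∀ c : Localization.AtPrime Q, algebraMap A _ x * c = 0 → c = 0 := fun c hc =>
    (mul_eq_zero.1 hc).resolve_left hx'
  have := (hn.free_of_depth _ (depth_localization hQ _) (.inr hreg)
    (.inr fun a ha => Subtype.ext (hreg _ (congrArg Subtype.val ha)))).2
  exact isPrincipal_of_free _

/-- If an integral fraction `a / b` is not in `A`, it is still missing from the localization at a
prime minimal over `(b : a)`. That localization is a valuation ring, hence integrally closed. -/
theorem HasFiniteResolutions.isIntegrallyClosed [IsDomain A] (h : HasFiniteResolutions A) :
    IsIntegrallyClosed A := by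
  rw [isIntegrallyClosed_iff (FractionRing A)]
  intro z hz
  obtain ⟨a, b, hb, rfl⟩ := IsFractionRing.div_surjective (A := A) z
  have hb := nonZeroDivisors.ne_zero hb
  have hb' : algebraMap A (FractionRing A) b ≠ 0 := by
    rwa [Ne, FaithfulSMul.algebraMap_eq_zero_iff]
  suffices b ∣ a by
    obtain ⟨c, rfl⟩ := this
    exact ⟨c, by rw [map_mul, mul_div_cancel_left₀ _ hb']⟩
  by_contra hab
  obtain ⟨⟨Q, hQ⟩⟩ := Ideal.nonempty_minimalPrimes (divisorIdeal_ne_top hab)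
  have := hQ.1.1
  have : IsDomain (Localization.AtPrime Q) :=
    IsLocalization.isDomain_localization Q.primeCompl_le_nonZeroDivisors
  have := h.valuationRing_localization hb hQ
  have : IsFractionRing (Localization.AtPrime Q) (FractionRing A) := inferInstance
  obtain ⟨c, hc⟩ := (isIntegrallyClosed_iff (R := Localization.AtPrime Q) (FractionRing A)).1
    inferInstance hz.tower_top
  refine not_dvd_localization hQ.1.2 (Localization.AtPrime Q) ⟨c, ?_⟩
  apply IsFractionRing.injective (Localization.AtPrime Q) (FractionRing A)
  rw [map_mul, hc, ← IsScalarTower.algebraMap_apply, ← IsScalarTower.algebraMap_apply,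
    mul_div_cancel₀ _ hb']

end

/-! ### A going-down argument -/

section

open Polynomial

theorem minpoly_algebraMap_mul {K L : Type*} [Field K] [Field L] [Algebra K L] {k : K}
    (hk : k ≠ 0) {s : L} (hs : IsIntegral K s) :
    minpoly K (algebraMap K L k * s) = (minpoly K s).scaleRoots k := by
  refine (minpoly.unique K _ ((monic_scaleRoots_iff k).2 (minpoly.monic hs))
    (scaleRoots_aeval_eq_zero (minpoly.aeval K s)) fun q hq hq0 => ?_).symm
  rw [degree_scaleRoots, ← degree_scaleRoots q (s := k⁻¹)]
  refine minpoly.min K s ((monic_scaleRoots_iff _).2 hq) ?_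
  have := scaleRoots_aeval_eq_zero (r := k⁻¹) hq0
  rwa [← mul_assoc, ← map_mul, inv_mul_cancel₀ hk, map_one, one_mul] at this

/-- If `x ∣ y` locally at a prime `P` of an integral extension of an integrally closed domain,
then `y` lies in the radical of `(x)` locally at the contraction of `P`. -/
theorem exists_dvd_mul_pow_of_mul_eq_mul {R A : Type*} [CommRing R] [IsDomain R]
    [IsIntegrallyClosed R] [CommRing A] [IsDomain A] [Algebra R A] [FaithfulSMul R A]
    {x y : R} (hx : x ≠ 0) {s t : A} (hs : IsIntegral R s) (ht : IsIntegral R t)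
    (hst : algebraMap R A y * s = algebraMap R A x * t) (P : Ideal A) [P.IsPrime] (hsP : s ∉ P) :
    ∃ (c : R) (i : ℕ), algebraMap R A c ∉ P ∧ x ∣ c * y ^ i := by
  by_cases hy : y = 0
  · exact ⟨1, 1, by rw [map_one]; exact P.one_notMem, by simp [hy]⟩
  let K := FractionRing R
  let L := FractionRing A
  let := FractionRing.liftAlgebra R L
  have : IsScalarTower R K L := inferInstance
  have hx' : algebraMap R K x ≠ 0 := by rwa [Ne, FaithfulSMul.algebraMap_eq_zero_iff]
  have hy' : algebraMap R K y ≠ 0 := by rwa [Ne, FaithfulSMul.algebraMap_eq_zero_iff]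
  have hk : algebraMap R K y / algebraMap R K x ≠ 0 := div_ne_zero hy' hx'
  have hsL : IsIntegral K (algebraMap A L s) := (hs.algebraMap).tower_top
  have htL : algebraMap A L t =
      algebraMap K L (algebraMap R K y / algebraMap R K x) * algebraMap A L s := by
    have hxL : algebraMap R L x ≠ 0 := by
      rw [IsScalarTower.algebraMap_apply R K L]
      exact (_root_.map_ne_zero _).2 hx'
    rw [map_div₀, ← IsScalarTower.algebraMap_apply, ← IsScalarTower.algebraMap_apply,
      div_mul_eq_mul_div, eq_div_iff hxL, mul_comm, IsScalarTower.algebraMap_apply R A L,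
      IsScalarTower.algebraMap_apply R A L, ← map_mul, ← map_mul, hst]
  have hmin := minpoly_algebraMap_mul hk hsL
  rw [← htL, minpoly.isIntegrallyClosed_eq_field_fractions K L ht,
    minpoly.isIntegrallyClosed_eq_field_fractions K L hs] at hmin
  set f := minpoly R s
  set g := minpoly R t
  have hf : f.Monic := minpoly.monic hs
  -- If all lower coefficients were in `P`, the equation `f(s) = 0` would put a power of `s` in `P`.
  obtain ⟨j, hj, hjP⟩ : ∃ j < f.natDegree, algebraMap R A (f.coeff j) ∉ P := by
    by_contra! hall
    have h0 : aeval s f = 0 := minpoly.aeval R s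
    rw [aeval_eq_sum_range, Finset.sum_range_succ, hf.coeff_natDegree, one_smul] at h0
    refine hsP (‹P.IsPrime›.mem_of_pow_mem f.natDegree ?_)
    rw [eq_neg_of_add_eq_zero_right h0]
    refine neg_mem (sum_mem fun i hi => ?_)
    rw [Algebra.smul_def]
    exact P.mul_mem_right _ (hall i (Finset.mem_range.1 hi))
  obtain ⟨i, hi⟩ : ∃ i, f.natDegree - j = i + 1 := ⟨f.natDegree - j - 1, by omega⟩
  -- Since `t = (y / x) s`, the coefficients satisfy `g_j = f_j (y / x) ^ (i + 1)`. Both lie in `R`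
  -- because `R` is integrally closed, so clearing denominators shows that `x` divides `f_j y ^ (i +
  -- 1)`.
  have hcoeff := congrArg (fun q => q.coeff j) hmin
  simp only [coeff_map, coeff_scaleRoots, hf.natDegree_map, hi, div_pow] at hcoeff
  rw [mul_div_assoc', eq_div_iff (pow_ne_zero _ hx'), ← map_pow, ← map_pow, ← map_mul,
    ← map_mul] at hcoeff
  refine ⟨f.coeff j, i + 1, hjP, g.coeff j * x ^ i, ?_⟩
  rw [← IsFractionRing.injective R K hcoeff]
  ring

theorem isIntegrallyClosed_of_dvd {R A : Type*} [CommRing R] [IsDomain R] [CommRing A]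
    [IsDomain A] [IsIntegrallyClosed A] [Algebra R A] [FaithfulSMul R A]
    (h : ∀ a b : R, algebraMap R A b ∣ algebraMap R A a → b ∣ a) : IsIntegrallyClosed R := by
  let K := FractionRing R
  let L := FractionRing A
  let := FractionRing.liftAlgebra R L
  have : IsScalarTower R K L := inferInstance
  rw [isIntegrallyClosed_iff K]
  intro z hz
  obtain ⟨a, b, hb, rfl⟩ := IsFractionRing.div_surjective (A := R) z
  have hb' : algebraMap R K b ≠ 0 := by
    rw [Ne, FaithfulSMul.algebraMap_eq_zero_iff]
    exact nonZeroDivisors.ne_zero hb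
  obtain ⟨c, hc⟩ := (isIntegrallyClosed_iff (R := A) L).1 inferInstance
    (hz.algebraMap (B := L)).tower_top
  have hab : b ∣ a := by
    refine h a b ⟨c, IsFractionRing.injective A L ?_⟩
    rw [map_mul, hc, ← IsScalarTower.algebraMap_apply, ← IsScalarTower.algebraMap_apply,
      IsScalarTower.algebraMap_apply R K L, IsScalarTower.algebraMap_apply R K L, ← map_mul,
      mul_div_cancel₀ _ hb']
  obtain ⟨c, rfl⟩ := hab
  exact ⟨c, by rw [map_mul, mul_div_cancel_left₀ _ hb']⟩

end

/-! ### Module retracts -/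

section

variable {R : Type u} {S : Type v} [CommRing R] [CommRing S] [Algebra R S]

/-- The largest ideal of `S` inside `ρ⁻¹(p)` contracts into `p`, because `ρ` fixes `R`. Lying over
yields a prime `Q` above `p` containing it, and this containment is the last clause. -/
theorem exists_prime_of_retract [Algebra.IsIntegral R S] {ρ : S →ₗ[R] R}
    (hρ : ∀ r, ρ (algebraMap R S r) = r) (p : Ideal R) [p.IsPrime] :
    ∃ (Q : Ideal S) (_ : Q.IsPrime), p = Q.comap (algebraMap R S) ∧
      ∀ t ∉ Q, ∃ w, ρ (t * w) ∉ p := by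
  let c : Ideal S :=
    { carrier := {s | ∀ w, ρ (s * w) ∈ p}
      add_mem' := fun {a b} ha hb w => by rw [add_mul, map_add]; exact add_mem (ha w) (hb w)
      zero_mem' := fun w => by simp
      smul_mem' := fun a s hs w => by
        rw [smul_eq_mul, mul_comm a, mul_assoc]; exact hs (a * w) }
  obtain ⟨Q, hcQ, hQ, hQp⟩ := Ideal.exists_ideal_over_prime_of_isIntegral p c fun r hr => by
    have := hr 1
    rwa [mul_one, hρ] at this
  refine ⟨Q, hQ, hQp.symm, fun t ht => ?_⟩
  by_contra! h
  exact ht (hcQ h)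

variable {ρ : S →ₗ[R] R} {p : Ideal R} {Q : Ideal S} [Q.IsPrime]

/-- Divisibility in `S_Q` means `u a = b v` in `S` with `u ∉ Q`. Multiplying by `w` and applying `ρ`
gives `ρ(u w) a = b ρ(v w)`, where `w` is chosen so that `ρ(u w) ∉ p`. -/
theorem exists_dvd_mul_of_dvd_localization (hQ : ∀ t ∉ Q, ∃ w, ρ (t * w) ∉ p) {a b : R}
    (h : algebraMap S (Localization.AtPrime Q) (algebraMap R S b) ∣
      algebraMap S (Localization.AtPrime Q) (algebraMap R S a)) :
    ∃ d ∉ p, b ∣ d * a := by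
  obtain ⟨z, hz⟩ := h
  obtain ⟨⟨m, s⟩, hs⟩ := IsLocalization.surj Q.primeCompl z
  have : algebraMap S (Localization.AtPrime Q) (algebraMap R S a * s) =
      algebraMap S (Localization.AtPrime Q) (algebraMap R S b * m) := by
    rw [map_mul, hz, mul_assoc, hs, map_mul]
  obtain ⟨t, ht⟩ := (IsLocalization.eq_iff_exists Q.primeCompl _).1 this
  obtain ⟨w, hw⟩ := hQ (s * t : Q.primeCompl) (s * t : Q.primeCompl).2
  refine ⟨_, hw, ρ (t * m * w), ?_⟩
  rw [mul_comm, ← smul_eq_mul a, ← smul_eq_mul b, ← map_smul, ← map_smul, Algebra.smul_def,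
    Algebra.smul_def]
  congr 1
  push_cast
  linear_combination w * ht

variable [p.IsPrime]

theorem dvd_of_localRingHom_dvd (hpQ : p = Q.comap (algebraMap R S)) (hQ : ∀ t ∉ Q, ∃ w, ρ (t * w) ∉ p)
    {a b : Localization.AtPrime p}
    (h : Localization.localRingHom p Q (algebraMap R S) hpQ b ∣
      Localization.localRingHom p Q (algebraMap R S) hpQ a) : b ∣ a := by
  obtain ⟨⟨a', s⟩, hs⟩ := IsLocalization.surj p.primeCompl a
  obtain ⟨⟨b', t⟩, ht⟩ := IsLocalization.surj p.primeCompl b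
  have hs' := IsLocalization.map_units (Localization.AtPrime p) s
  have ht' := IsLocalization.map_units (Localization.AtPrime p) t
  rw [← hs'.dvd_mul_right, hs, ← ht'.mul_right_dvd, ht]
  rw [← (hs'.map (Localization.localRingHom p Q (algebraMap R S) hpQ)).dvd_mul_right, ← map_mul, hs,
    ← (ht'.map (Localization.localRingHom p Q (algebraMap R S) hpQ)).mul_right_dvd, ← map_mul, ht,
    Localization.localRingHom_to_map, Localization.localRingHom_to_map] at h
  obtain ⟨d, hd, hda⟩ := exists_dvd_mul_of_dvd_localization hQ h
  have := map_dvd (algebraMap R (Localization.AtPrime p)) hda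
  rwa [map_mul, ((IsLocalization.AtPrime.isUnit_to_map_iff _ p d).2 hd).dvd_mul_left] at this

theorem isDomain_localization_of_retract [Algebra.IsIntegral R S]
    (hρ : ∀ r, ρ (algebraMap R S r) = r) (hS : HasFiniteResolutions S)
    (p : Ideal R) [p.IsPrime] :
    IsDomain (Localization.AtPrime p) := by
  obtain ⟨Q, _, hpQ, hQ⟩ := exists_prime_of_retract hρ p
  have : IsDomain (Localization.AtPrime Q) :=
    (hS.of_isLocalization Q.primeCompl (Localization.AtPrime Q)).isDomain
  refine Function.Injective.isDomain (Localization.localRingHom p Q (algebraMap R S) hpQ)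
    ((injective_iff_map_eq_zero _).2 fun a ha => ?_)
  rw [← zero_dvd_iff]
  exact dvd_of_localRingHom_dvd hpQ hQ (by rw [ha]; exact dvd_zero _)

/-- Here `exists_dvd_mul_pow_of_mul_eq_mul` is applied to `R_p → S_Q`. This extension need not be
integral, but images of elements of `S` are integral over `R_p`, and denominators can be cleared to
use only those. -/
theorem exists_dvd_mul_pow_of_dvd_localization [Algebra.IsIntegral R S]
    (hρ : ∀ r, ρ (algebraMap R S r) = r) (hS : HasFiniteResolutions S)
    (hpQ : p = Q.comap (algebraMap R S)) (hQ : ∀ t ∉ Q, ∃ w, ρ (t * w) ∉ p)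
    (P : Ideal (Localization.AtPrime Q)) [P.IsPrime] {x y : R}
    (hx : algebraMap R (Localization.AtPrime Q) x ≠ 0)
    (hxy : algebraMap (Localization.AtPrime Q) (Localization.AtPrime P)
        (algebraMap R (Localization.AtPrime Q) x) ∣
      algebraMap (Localization.AtPrime Q) (Localization.AtPrime P)
        (algebraMap R (Localization.AtPrime Q) y)) :
    ∃ (d : R) (i : ℕ), d ∉ P.comap (algebraMap R (Localization.AtPrime Q)) ∧ x ∣ d * y ^ i := by
  have hA := hS.of_isLocalization Q.primeCompl (Localization.AtPrime Q)
  have : IsDomain (Localization.AtPrime Q) := hA.isDomain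
  have := hA.isIntegrallyClosed
  have := isDomain_localization_of_retract hρ hS p
  let := (Localization.localRingHom p Q (algebraMap R S) hpQ).toAlgebra
  have hdvd : ∀ a b : Localization.AtPrime p, algebraMap _ (Localization.AtPrime Q) b ∣
      algebraMap _ (Localization.AtPrime Q) a → b ∣ a := fun a b h =>
    dvd_of_localRingHom_dvd hpQ hQ h
  have : FaithfulSMul (Localization.AtPrime p) (Localization.AtPrime Q) := by
    rw [faithfulSMul_iff_algebraMap_injective, injective_iff_map_eq_zero]
    exact fun a ha => zero_dvd_iff.1 (hdvd _ _ (by rw [ha]; exact dvd_zero _))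
  have := isIntegrallyClosed_of_dvd hdvd
  have : IsScalarTower R (Localization.AtPrime p) (Localization.AtPrime Q) :=
    IsScalarTower.of_algebraMap_eq fun r =>
      (Localization.localRingHom_to_map p Q (algebraMap R S) hpQ r).symm
  have hint : ∀ s : S, IsIntegral (Localization.AtPrime p)
      (algebraMap S (Localization.AtPrime Q) s) := fun s =>
    ((Algebra.IsIntegral.isIntegral (R := R) s).algebraMap).tower_top
  obtain ⟨z, hz⟩ := hxy
  obtain ⟨⟨a, w⟩, hw⟩ := IsLocalization.surj P.primeCompl z
  have haw : algebraMap R (Localization.AtPrime Q) y * w =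
      algebraMap R (Localization.AtPrime Q) x * a := by
    apply IsLocalization.injective (Localization.AtPrime P) P.primeCompl_le_nonZeroDivisors
    rw [map_mul, hz, mul_assoc, hw, map_mul]
  obtain ⟨⟨a', m⟩, hm⟩ := IsLocalization.surj Q.primeCompl a
  obtain ⟨⟨w', n⟩, hn⟩ := IsLocalization.surj Q.primeCompl (w : Localization.AtPrime Q)
  have hmu := IsLocalization.map_units (Localization.AtPrime Q) m
  have hnu := IsLocalization.map_units (Localization.AtPrime Q) n
  have hsP : algebraMap S (Localization.AtPrime Q) (w' * m) ∉ P := by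
    rw [map_mul, ← hn, Ideal.mul_unit_mem_iff_mem _ hmu, Ideal.mul_unit_mem_iff_mem _ hnu]
    exact w.2
  have hst : algebraMap (Localization.AtPrime p) (Localization.AtPrime Q) (algebraMap R _ y) *
        algebraMap S (Localization.AtPrime Q) (w' * m) =
      algebraMap (Localization.AtPrime p) (Localization.AtPrime Q) (algebraMap R _ x) *
        algebraMap S (Localization.AtPrime Q) (a' * n) := by
    rw [← IsScalarTower.algebraMap_apply, ← IsScalarTower.algebraMap_apply, map_mul, map_mul,
      ← hn, ← hm]
    linear_combination (algebraMap S (Localization.AtPrime Q) n *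
      algebraMap S (Localization.AtPrime Q) m) * haw
  have hx' : algebraMap R (Localization.AtPrime p) x ≠ 0 := fun h => hx (by
    rw [IsScalarTower.algebraMap_apply R (Localization.AtPrime p), h, map_zero])
  obtain ⟨c, i, hc, hci⟩ := exists_dvd_mul_pow_of_mul_eq_mul hx' (hint _) (hint _) hst P hsP
  obtain ⟨⟨c', l⟩, hl⟩ := IsLocalization.surj p.primeCompl c
  have hlu := IsLocalization.map_units (Localization.AtPrime p) l
  have hdiv : algebraMap R (Localization.AtPrime p) x ∣
      algebraMap R (Localization.AtPrime p) (c' * y ^ i) := by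
    rw [map_mul, ← hl, map_pow, mul_right_comm]
    exact hci.mul_right _
  have hdiv := map_dvd (algebraMap (Localization.AtPrime p) (Localization.AtPrime Q)) hdiv
  rw [← IsScalarTower.algebraMap_apply, ← IsScalarTower.algebraMap_apply,
    IsScalarTower.algebraMap_apply R S, IsScalarTower.algebraMap_apply R S] at hdiv
  obtain ⟨d, hd, hdx⟩ := exists_dvd_mul_of_dvd_localization hQ hdiv
  refine ⟨d * c', i, ?_, by rwa [mul_assoc]⟩
  have hdu : IsUnit (algebraMap R (Localization.AtPrime Q) d) := by
    rw [IsScalarTower.algebraMap_apply R (Localization.AtPrime p)]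
    exact ((IsLocalization.AtPrime.isUnit_to_map_iff _ p d).2 hd).map _
  rw [Ideal.mem_comap, map_mul, Ideal.unit_mul_mem_iff_mem _ hdu,
    IsScalarTower.algebraMap_apply R (Localization.AtPrime p), ← hl, map_mul,
    Ideal.mul_unit_mem_iff_mem _ (hlu.map _)]
  exact hc

/-- If `y` is a zero divisor modulo the nonzerodivisor `x`, then at some prime containing both
elements, one of them lies locally in the radical of the ideal generated by the other. -/
theorem exists_prime_dvd_mul_pow [Algebra.IsIntegral R S]
    (hρ : ∀ r, ρ (algebraMap R S r) = r) (hS : HasFiniteResolutions S) {x y r : R}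
    (hx : ∀ a, x * a = 0 → a = 0) (hxy : x ∣ r * y) (hxr : ¬ x ∣ r) :
    ∃ (p : Ideal R) (_ : p.IsPrime), x ∈ p ∧ y ∈ p ∧
      ∃ (d : R) (i : ℕ), d ∉ p ∧ (x ∣ d * y ^ i ∨ y ∣ d * x ^ i) := by
  -- A prime containing `(x : r)` ensures that `x` still fails to divide `r` in `S_Q`.
  obtain ⟨p, hp, hrp⟩ := Ideal.exists_le_maximal _ (divisorIdeal_ne_top hxr)
  have := hp.isPrime
  obtain ⟨Q, _, hpQ, hQ⟩ := exists_prime_of_retract hρ p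
  have hA := hS.of_isLocalization Q.primeCompl (Localization.AtPrime Q)
  have : IsDomain (Localization.AtPrime Q) := hA.isDomain
  have hxA : algebraMap R (Localization.AtPrime Q) x ≠ 0 := fun h => by
    rw [IsScalarTower.algebraMap_apply R S] at h
    obtain ⟨d, hd, hdx⟩ := exists_dvd_mul_of_dvd_localization hQ (a := x) (b := 0)
      (by rw [h]; exact dvd_zero _)
    rw [zero_dvd_iff, mul_comm] at hdx
    exact hd (hx d hdx ▸ p.zero_mem)
  have hxrA : ¬ algebraMap R (Localization.AtPrime Q) x ∣
      algebraMap R (Localization.AtPrime Q) r := fun h => by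
    rw [IsScalarTower.algebraMap_apply R S, IsScalarTower.algebraMap_apply R S] at h
    obtain ⟨d, hd, hdx⟩ := exists_dvd_mul_of_dvd_localization hQ h
    exact hd (hrp (mem_divisorIdeal.2 (by rwa [mul_comm])))
  obtain ⟨⟨P, hP⟩⟩ := Ideal.nonempty_minimalPrimes (divisorIdeal_ne_top hxrA)
  have := hP.1.1
  have := hA.valuationRing_localization hxA hP
  have : IsDomain (Localization.AtPrime P) :=
    IsLocalization.isDomain_localization P.primeCompl_le_nonZeroDivisors
  refine ⟨P.comap (algebraMap R (Localization.AtPrime Q)), inferInstance,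
    hP.1.2 (mem_divisorIdeal.2 (dvd_mul_left _ _)),
    hP.1.2 (mem_divisorIdeal.2 (by rw [← map_mul]; exact map_dvd _ hxy)), ?_⟩
  -- In the valuation ring at `P` one of `x`, `y` divides the other; both cases descend to `R` in
  -- the same way.
  by_cases h : algebraMap (Localization.AtPrime Q) (Localization.AtPrime P)
        (algebraMap R (Localization.AtPrime Q) x) ∣
      algebraMap (Localization.AtPrime Q) (Localization.AtPrime P)
        (algebraMap R (Localization.AtPrime Q) y)
  · obtain ⟨d, i, hd, hdi⟩ := exists_dvd_mul_pow_of_dvd_localization hρ hS hpQ hQ P hxA h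
    exact ⟨d, i, hd, .inl hdi⟩
  · have hyA : algebraMap R (Localization.AtPrime Q) y ≠ 0 := fun h0 => h (by
      rw [h0, map_zero]; exact dvd_zero _)
    obtain ⟨d, i, hd, hdi⟩ := exists_dvd_mul_pow_of_dvd_localization hρ hS hpQ hQ P hyA
      ((ValuationRing.dvd_total _ _).resolve_left h)
    exact ⟨d, i, hd, .inr hdi⟩

end

/-! ### Vanishing of Čech cohomology -/

section

variable {R : Type u} [CommRing R]

/-- The condition ranges over all cochains rather than cocycles, which loses nothing in the top
degree of a Čech complex. -/
theorem subsingleton_localized_homology (K : CochainComplex (ModuleCat.{u} R) ℕ) (n : ℕ)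
    (p : Ideal R) [p.IsPrime]
    (h : ∀ z : K.X (n + 1), ∃ d ∉ p, ∃ w : K.X n, (K.d n (n + 1)).hom w = d • z) :
    Subsingleton (LocalizedModule p.primeCompl (K.homology (n + 1))) := by
  rw [LocalizedModule.subsingleton_iff]
  intro m
  obtain ⟨z, rfl⟩ := (ModuleCat.epi_iff_surjective (K.homologyπ (n + 1))).1 inferInstance m
  obtain ⟨d, hd, w, hw⟩ := h ((K.iCycles (n + 1)).hom z)
  refine ⟨d, hd, ?_⟩
  have hz : (K.toCycles n (n + 1)).hom w = d • z := by
    apply (ModuleCat.mono_iff_injective (K.iCycles (n + 1))).1 inferInstance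
    have := congrArg (fun f => f.hom w) (K.toCycles_i n (n + 1))
    exact this.trans (hw.trans (map_smul _ _ _).symm)
  have := congrArg (fun f => f.hom w) (K.toCycles_comp_homologyπ n (n + 1))
  change (K.homologyπ (n + 1)).hom ((K.toCycles n (n + 1)).hom w) = 0 at this
  rwa [hz, map_smul] at this

theorem subsingleton_cechNil (n : ℕ) : Subsingleton ((cechNil R).X (n + 1)) :=
  ModuleCat.subsingleton_of_isZero
    (HomologicalComplex.isZero_single_obj_X _ _ _ _ (Nat.succ_ne_zero n))

theorem subsingleton_localizedModule (W : Submonoid R) (M : Type u) [AddCommGroup M] [Module R M]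
    [Subsingleton M] : Subsingleton (LocalizedModule W M) :=
  LocalizedModule.subsingleton_iff.2 fun _ => ⟨1, W.one_mem, Subsingleton.elim _ _⟩

theorem subsingleton_cechStep {K : CochainComplex (ModuleCat.{u} R) ℕ} (x : R) {n : ℕ}
    (h : Subsingleton (K.X n)) (h' : Subsingleton (K.X (n + 1))) :
    Subsingleton ((cechStep K x).X (n + 1)) := by
  have := subsingleton_localizedModule (Submonoid.powers x) (K.X n)
  exact inferInstanceAs (Subsingleton (K.X (n + 1) × LocalizedModule _ (K.X n)))

theorem cechStep_d (K : CochainComplex (ModuleCat.{u} R) ℕ) (x : R) (n : ℕ) :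
    (cechStep K x).d n (n + 1) = cechStepD K x n :=
  CochainComplex.of_d _ _ _

/-- Since `x` acts invertibly on the localization and `d * x = 0`, the element `d` must act as zero.
-/
theorem smul_mk_eq_zero {x d : R} (hdx : d * x = 0) {N : Type u} [AddCommGroup N] [Module R N]
    (z : LocalizedModule (Submonoid.powers x) N) : d • z = 0 := by
  induction z using LocalizedModule.induction_on with
  | _ n s =>
    rw [LocalizedModule.smul'_mk, ← LocalizedModule.zero_mk s, LocalizedModule.mk_eq]
    refine ⟨⟨x, Submonoid.mem_powers x⟩, ?_⟩
    simp only [Submonoid.smul_def, smul_zero, smul_smul]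
    rw [mul_left_comm, mul_comm x, hdx, mul_zero, zero_smul]

theorem subsingleton_localized_cechCohomology_singleton {x d : R} {p : Ideal R} [p.IsPrime]
    (hd : d ∉ p) (hdx : d * x = 0) :
    Subsingleton (LocalizedModule p.primeCompl (cechCohomology [x] 1)) := by
  refine subsingleton_localized_homology (cechStep (cechNil R) x) 0 p fun z => ⟨d, hd, 0, ?_⟩
  rw [map_zero]
  have := subsingleton_cechNil (R := R) 0
  refine Prod.ext (Subsingleton.elim (α := (cechNil R).X 1) _ _) ?_
  change 0 = d • (z.2 : LocalizedModule (Submonoid.powers x) ((cechNil R).X 0))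
  exact (smul_mk_eq_zero hdx _).symm

/-- With `K` zero in degree `n + 2`, only the localized summand of the target survives. It is
reached by the localized differential of `K` from one summand and, up to sign, by the localization
map from the other. -/
theorem exists_cechStep_d_eq {K : CochainComplex (ModuleCat.{u} R) ℕ} {y d : R} {n : ℕ}
    (hK : Subsingleton (K.X (n + 2)))
    (z : K.X (n + 2) × LocalizedModule (Submonoid.powers y) (K.X (n + 1)))
    (h : (∃ w, d • z.2 = awayMap y (K.d n (n + 1)).hom w) ∨
      ∃ w, d • z.2 = LocalizedModule.mkLinearMap (Submonoid.powers y) _ w) :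
    ∃ w, ((cechStep K y).d (n + 1) (n + 2)).hom w = d • z := by
  rw [cechStep_d]
  rcases h with ⟨w, hw⟩ | ⟨w, hw⟩
  · refine ⟨((0 : K.X (n + 1)), w), Prod.ext (Subsingleton.elim (α := K.X (n + 2)) _ _) ?_⟩
    change awayMap y (K.d n (n + 1)).hom w + (-1 : R) ^ (n + 1) •
      LocalizedModule.mkLinearMap (Submonoid.powers y) (K.X (n + 1)) 0 = d • z.2
    rw [map_zero, smul_zero, add_zero, hw]
  · refine ⟨((-1 : R) ^ (n + 1) • w, 0), Prod.ext (Subsingleton.elim (α := K.X (n + 2)) _ _) ?_⟩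
    change awayMap y (K.d n (n + 1)).hom 0 + (-1 : R) ^ (n + 1) •
      LocalizedModule.mkLinearMap (Submonoid.powers y) (K.X (n + 1)) ((-1 : R) ^ (n + 1) • w) =
        d • z.2
    rw [map_zero, zero_add, map_smul, smul_smul, ← mul_pow, neg_one_mul, neg_neg, one_pow,
      one_smul, hw]

/-- The identity is `d ^ a / (x ^ a y ^ k) = b ^ a / y ^ (k + i a)`: multiplication by `d ^ a`
removes `x` from the denominator, landing in the image of `N_y`. The module `V` is the vanishing
degree-one term of the trivial complex. -/
theorem exists_smul_eq_awayMap {x y d b : R} {i : ℕ} (h : d * y ^ i = x * b) {V N : Type u}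
    [AddCommGroup V] [Module R V] [Subsingleton V] [AddCommGroup N] [Module R N]
    (g : N →ₗ[R] V × LocalizedModule (Submonoid.powers x) N)
    (hg : ∀ n, (g n).2 = LocalizedModule.mkLinearMap (Submonoid.powers x) N n)
    (z : LocalizedModule (Submonoid.powers y) (V × LocalizedModule (Submonoid.powers x) N)) :
    ∃ (a : ℕ) (w : LocalizedModule (Submonoid.powers y) N), d ^ a • z = awayMap y g w := by
  induction z using LocalizedModule.induction_on with
  | _ v s =>
    obtain ⟨v₁, v₂⟩ := v
    obtain ⟨s, k, rfl⟩ := s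
    induction v₂ using LocalizedModule.induction_on with
    | _ n t =>
      obtain ⟨t, a, rfl⟩ := t
      refine ⟨a, LocalizedModule.mk (b ^ a • n) ⟨y ^ (k + i * a), k + i * a, rfl⟩, ?_⟩
      rw [awayMap_mk, LocalizedModule.smul'_mk, LocalizedModule.mk_eq]
      refine ⟨1, ?_⟩
      rw [one_smul, one_smul]
      refine Prod.ext (Subsingleton.elim _ _) ?_
      simp only [Submonoid.smul_def, Prod.smul_snd, hg, LocalizedModule.mkLinearMap_apply,
        LocalizedModule.smul'_mk, LocalizedModule.mk_eq]
      refine ⟨1, ?_⟩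
      simp only [smul_smul]
      congr 1
      have := congrArg (fun q => y ^ k * q ^ a) h
      simp only [mul_pow, ← pow_mul] at this
      push_cast
      rw [pow_add]
      linear_combination this

/-- Symmetrically, `d ^ k / (x ^ a y ^ k) = b ^ k / x ^ (a + i k)` has no `y` in the denominator and
comes from `N_x`. -/
theorem exists_smul_eq_mkLinearMap {x y d b : R} {i : ℕ} (h : d * x ^ i = y * b) {V N : Type u}
    [AddCommGroup V] [Module R V] [Subsingleton V] [AddCommGroup N] [Module R N]
    (z : LocalizedModule (Submonoid.powers y) (V × LocalizedModule (Submonoid.powers x) N)) :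
    ∃ (k : ℕ) (w : V × LocalizedModule (Submonoid.powers x) N),
      d ^ k • z = LocalizedModule.mkLinearMap (Submonoid.powers y) _ w := by
  induction z using LocalizedModule.induction_on with
  | _ v s =>
    obtain ⟨v₁, v₂⟩ := v
    obtain ⟨s, k, rfl⟩ := s
    induction v₂ using LocalizedModule.induction_on with
    | _ n t =>
      obtain ⟨t, a, rfl⟩ := t
      refine ⟨k, (0, LocalizedModule.mk (b ^ k • n) ⟨x ^ (a + i * k), a + i * k, rfl⟩), ?_⟩
      rw [LocalizedModule.mkLinearMap_apply, LocalizedModule.smul'_mk, LocalizedModule.mk_eq]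
      refine ⟨1, ?_⟩
      rw [one_smul, one_smul]
      refine Prod.ext (Subsingleton.elim _ _) ?_
      simp only [Submonoid.smul_def, Prod.smul_snd, LocalizedModule.smul'_mk,
        LocalizedModule.mk_eq]
      refine ⟨1, ?_⟩
      simp only [smul_smul]
      congr 1
      have := congrArg (fun q => x ^ a * q ^ k) h
      simp only [mul_pow, ← pow_mul] at this
      push_cast
      rw [pow_add]
      linear_combination this

theorem subsingleton_localized_cechCohomology_pair {x y d : R} {i : ℕ} {p : Ideal R} [p.IsPrime]
    (hd : d ∉ p) (h : x ∣ d * y ^ i ∨ y ∣ d * x ^ i) :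
    Subsingleton (LocalizedModule p.primeCompl (cechCohomology [x, y] 2)) := by
  have hX1 := subsingleton_cechNil (R := R) 0
  have hX2 := subsingleton_cechStep x hX1 (subsingleton_cechNil (R := R) 1)
  have hdp : ∀ k : ℕ, d ^ k ∉ p := fun k hk => hd (‹p.IsPrime›.mem_of_pow_mem _ hk)
  refine subsingleton_localized_homology (cechStep (cechStep (cechNil R) x) y) 1 p fun z => ?_
  rcases h with ⟨b, hb⟩ | ⟨b, hb⟩
  · obtain ⟨k, w, hw⟩ := exists_smul_eq_awayMap (V := (cechNil R).X 1) (N := (cechNil R).X 0) hb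
      ((cechStep (cechNil R) x).d 0 1).hom (fun n => by rw [cechStep_d]; rfl) z.2
    exact ⟨d ^ k, hdp k, exists_cechStep_d_eq hX2 z (.inl ⟨w, hw⟩)⟩
  · obtain ⟨k, w, hw⟩ := exists_smul_eq_mkLinearMap (V := (cechNil R).X 1) (N := (cechNil R).X 0)
      hb z.2
    exact ⟨d ^ k, hdp k, exists_cechStep_d_eq hX2 z (.inr ⟨w, hw⟩)⟩

end

/-! ### From strong parameter sequences to regular sequences -/

theorem IsStrongParameterSequence.isRegularSequence {R : Type u} {S : Type v} [CommRing R]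
    [CommRing S] [Algebra R S] [Algebra.IsIntegral R S] (hretract : IsModuleRetract R S)
    (hS : HasFiniteResolutions S) {xs : List R} (hxs : IsStrongParameterSequence xs)
    (hlen : xs.length ≤ 2) : IsRegularSequence xs := by
  obtain ⟨ρ, hρ⟩ := hretract
  have hreg : ∀ x : R, IsParameterSequence [x] → ∀ a, x * a = 0 → a = 0 := by
    intro x hx a ha
    by_contra ha0
    -- At a prime containing the annihilator of `a`, the element `a` survives in the domain `R_p`,
    -- so `x` must vanish there, and with it the localized `H¹`.
    obtain ⟨p, hp, hap⟩ := Ideal.exists_le_maximal (divisorIdeal 0 a)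
      (divisorIdeal_ne_top (by rwa [zero_dvd_iff]))
    have := hp.isPrime
    have hxp : x ∈ p := hap (mem_divisorIdeal.2 (by rw [mul_comm, ha]))
    have := isDomain_localization_of_retract hρ hS p
    have h0 : algebraMap R (Localization.AtPrime p) x * algebraMap R _ a = 0 := by
      rw [← map_mul, ha, map_zero]
    rcases mul_eq_zero.1 h0 with h0 | h0
    · obtain ⟨⟨d, hd⟩, hdx⟩ := (IsLocalization.map_eq_zero_iff p.primeCompl _ _).1 h0
      have := subsingleton_localized_cechCohomology_singleton hd hdx
      have := hx.nontrivial_localized p (by simpa [Ideal.ofList] using hxp)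
      exact false_of_nontrivial_of_subsingleton
        (LocalizedModule p.primeCompl (cechCohomology [x] 1))
    · obtain ⟨⟨d, hd⟩, hda⟩ := (IsLocalization.map_eq_zero_iff p.primeCompl _ _).1 h0
      exact hd (hap (mem_divisorIdeal.2 (by rw [mul_comm]; exact hda ▸ dvd_rfl)))
  match xs, hlen with
  | [], _ => exact .inl rfl
  | [x], _ =>
    have hx : IsParameterSequence [x] := hxs 1 le_rfl le_rfl
    refine .inr ((RingTheory.Sequence.isRegular_iff _ _).2
      ⟨(RingTheory.Sequence.isWeaklyRegular_singleton_iff _ _).2 ?_, ?_⟩)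
    · exact IsSMulRegular.of_right_eq_zero_of_smul fun a ha => hreg x hx a ha
    · simpa using hx.ne_top.symm
  | [x, y], _ =>
    have hx : IsParameterSequence [x] := hxs 1 le_rfl (by simp)
    have hxy : IsParameterSequence [x, y] := hxs 2 (by simp) le_rfl
    refine .inr ((RingTheory.Sequence.isRegular_iff _ _).2
      ⟨(RingTheory.Sequence.isWeaklyRegular_cons_iff _ _ _).2
        ⟨IsSMulRegular.of_right_eq_zero_of_smul fun a ha => hreg x hx a ha,
          (RingTheory.Sequence.isWeaklyRegular_singleton_iff _ _).2
            (IsSMulRegular.of_right_eq_zero_of_smul fun a ha => ?_)⟩, ?_⟩)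
    · obtain ⟨r, rfl⟩ := Submodule.Quotient.mk_surjective _ a
      rw [← Submodule.Quotient.mk_smul, Submodule.Quotient.mk_eq_zero,
        Submodule.mem_smul_pointwise_iff_exists] at ha
      obtain ⟨b, -, hb⟩ := ha
      rw [Submodule.Quotient.mk_eq_zero, Submodule.mem_smul_pointwise_iff_exists]
      by_contra hr
      obtain ⟨p, _, hxp, hyp, d, i, hd, hdi⟩ := exists_prime_dvd_mul_pow hρ hS (hreg x hx)
        (y := y) (r := r) ⟨b, by rw [mul_comm]; exact hb.symm⟩
        fun ⟨c, hc⟩ => hr ⟨c, trivial, hc.symm⟩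
      have := subsingleton_localized_cechCohomology_pair hd hdi
      have := hxy.nontrivial_localized p (Ideal.span_le.2 (by
        rintro z hz
        simp only [List.mem_cons, List.not_mem_nil, or_false, Set.mem_ofPred_eq] at hz
        rcases hz with rfl | rfl <;> assumption))
      exact false_of_nontrivial_of_subsingleton
        (LocalizedModule p.primeCompl (cechCohomology [x, y] 2))
    · simpa only [smul_eq_mul, Ideal.mul_top] using hxy.ne_top.symm

end NonNoetherian

theorem theorem4p14 {R : Type u} {S : Type v} [CommRing R] [CommRing S] [Algebra R S]
    (hretract : NonNoetherian.IsModuleRetract R S)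
    (hfinite : Module.Finite R S)
    (hcoherent : NonNoetherian.IsCoherentRing S)
    (hregular : NonNoetherian.IsRegularRing S)
    (xs : List R) (hxs : NonNoetherian.IsStrongParameterSequence xs) (hlen : xs.length ≤ 2) :
    NonNoetherian.IsRegularSequence xs :=
  hxs.isRegularSequence hretract (hcoherent.hasFiniteResolutions hregular) hlen
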